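/- **Setting.** Messages are generated by $$M,N ::= a \mid x \mid \mathsf{pub}(M) \mid \mathsf{sign}(M,N) \mid \mathsf{blind}(M,N) \mid \langle M,N\rangle \mid \{M\}_N \mid f(M_1,\dots,M_k),$$ where $a$ ranges over a countably infinite set of names, $x$ over a countably infinite set of variables, and $f$ over a signature $\Sigma_E$ disjoint from the set of constructors $\{\mathsf{pub},\mathsf{sign},\mathsf{blind},\langle\_,\_\rangle,\{\_\}_{\_}\}$; $\Sigma_E$ contains at most one distinguished associative-commutative (AC) binary symbol $\oplus$. A message is *ground* if it contains no variables. Let $\equiv$ be equality of messages modulo AC of $\oplus$. Let $E$ be an equational theory given by equations between terms built from variables and symbols of $\Sigma_E$, in which $\oplus$ (if present) is AC, and let $\approx_E$ be equality modulo $E$ on messages. Assume that $E$ is *AC-convergent*: there is a set $R_E$ of rewrite rules $l\to r$ between terms built from variables and symbols of $\Sigma_E$, with every variable of $r$ occurring in $l$, such that $\approx_E$ is the equality generated by $R_E$ and AC, and such that rewriting modulo AC on messages ($M\to N$ iff $M\equiv M'$, $M'$ rewrites to $N'$ by one application of a rule of $R_E$, and $N'\equiv N$, for some $M',N'$) is terminating,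 and confluent modulo $\equiv$. A message is in *normal form* if it cannot be rewritten in this way. An *$E$-context* is a term with holes formed using only symbols of $\Sigma_E$. A message $A$ is an *$E$-factor* of $N$ if $A$ is headed by a constructor and is an immediate subterm of some subterm of $N$ headed by a symbol of $\Sigma_E$; it is an $E$-factor of a set of messages if it is an $E$-factor of one of its elements. A *sequent* $\Gamma\vdash M$ consists of a set $\Gamma$ of messages and a message $M$; all sequents, including all those in derivations, consist of ground messages in normal form. Write $\Gamma,M$ for $\Gamma\cup\{M\}$. The sequent system $\mathcal S$ has the following rules (premises $\Rightarrow$ conclusion): - $id$: no premise $\Rightarrow \Gamma\vdash M$, if $M\approx_E C[M_1,\dots,M_k]$ for some $E$-context $C[\ldots]$ and $M_1,\dots,M_k\in\Gamma$; - $cut$: $\Gamma\vdash M$ and $\Gamma,M\vdash T$ $\Rightarrow$ $\Gamma\vdash T$; - $p_L$: $\Gamma,\langle M,N\rangle,M,N\vdash T$ $\Rightarrow$ $\Gamma,\langle M,N\rangle\vdash T$; - $e_L$: $\Gamma,\{M\}_K\vdash K$ and $\Gamma,\{M\}_K,M,K\vdash N$ $\Rightarrow$ $\Gamma,\{M\}_K\vdash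 N$; - $\mathsf{sign}_L$: $\Gamma,\mathsf{sign}(M,K),\mathsf{pub}(L),M\vdash N$ $\Rightarrow$ $\Gamma,\mathsf{sign}(M,K),\mathsf{pub}(L)\vdash N$, if $K\equiv L$; - $\mathsf{blind}_{L1}$: $\Gamma,\mathsf{blind}(M,K)\vdash K$ and $\Gamma,\mathsf{blind}(M,K),M,K\vdash N$ $\Rightarrow$ $\Gamma,\mathsf{blind}(M,K)\vdash N$; - $\mathsf{blind}_{L2}$: with $B=\mathsf{sign}(\mathsf{blind}(M,R),K)$: $\Gamma,B\vdash R$ and $\Gamma,B,\mathsf{sign}(M,K),R\vdash N$ $\Rightarrow$ $\Gamma,B\vdash N$; - $p_R,e_R,\mathsf{sign}_R,\mathsf{blind}_R$: $\Gamma\vdash M$ and $\Gamma\vdash K$ $\Rightarrow$ $\Gamma\vdash f(M,K)$, for $f(M,K)$ being $\langle M,K\rangle$, $\{M\}_K$, $\mathsf{sign}(M,K)$, $\mathsf{blind}(M,K)$ respectively; - $acut$: $\Gamma\vdash A$ and $\Gamma,A\vdash M$ $\Rightarrow$ $\Gamma\vdash M$, if $A$ is an $E$-factor of $\Gamma\cup\{M\}$.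 **Theorem.** The cut rule is admissible for $\mathcal S$: every sequent derivable in $\mathcal S$ has a derivation in $\mathcal S$ without instances of $cut$. -/

import Mathlib

namespace Intruder

universe u

/-- The signature of an equational theory: function symbols with arities, and at most one
distinguished associative-commutative binary symbol. It is disjoint from the constructors
`pub, sign, blind, pair, enc` by construction of `Msg`. -/
structure Signature where
  Sym : Type u
  arity : Sym → ℕ
  oplus : Option Sym
  oplus_arity : ∀ f ∈ oplus, arity f = 2

/-- Messages over names `ℕ`, variables `ℕ`, the constructors, and the symbols of `S`. -/
inductive Msg (S : Signature.{u}) : Type u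
  | name (a : ℕ) : Msg S
  | var (x : ℕ) : Msg S
  | pub (M : Msg S) : Msg S
  | sign (M K : Msg S) : Msg S
  | blind (M K : Msg S) : Msg S
  | pair (M N : Msg S) : Msg S
  | enc (M K : Msg S) : Msg S
  | app (f : S.Sym) (args : Fin (S.arity f) → Msg S) : Msg S

/-- Terms built only from symbols of `S`, with leaves labelled by `X`. For `X = ℕ` these are the
terms over variables from which equations and rewrite rules are formed; for `X = Fin k` they are
contexts over `S` whose holes are to be filled with `k` messages. -/
inductive ETerm (S : Signature.{u}) (X : Type) : Type u
  | leaf (x : X) : ETerm S X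
  | app (f : S.Sym) (args : Fin (S.arity f) → ETerm S X) : ETerm S X

variable {S : Signature.{u}}

/-- Replace every leaf by a message: substitution instance, or filling of holes. -/
def ETerm.fill {X : Type} (σ : X → Msg S) : ETerm S X → Msg S
  | .leaf x => σ x
  | .app f args => .app f (fun i => (args i).fill σ)

/-- The set of leaves that occur in a term. -/
def ETerm.vars {X : Type} : ETerm S X → Set X
  | .leaf x => {x}
  | .app _ args => ⋃ i, (args i).vars

/-- A message without variables. -/
def Msg.Ground : Msg S → Prop
  | .name _ => True
  | .var _ => False
  | .pub M => M.Ground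
  | .sign M K => M.Ground ∧ K.Ground
  | .blind M K => M.Ground ∧ K.Ground
  | .pair M N => M.Ground ∧ N.Ground
  | .enc M K => M.Ground ∧ K.Ground
  | .app _ args => ∀ i, (args i).Ground

/-- The term `f(s, t)`, for `f` of arity two. -/
def ETerm.bin {X : Type} (f : S.Sym) (s t : ETerm S X) : ETerm S X :=
  .app f (fun i => if i.val = 0 then s else t)

/-- Commutativity and associativity of the distinguished symbol, if there is one. -/
def acEqns (S : Signature.{u}) : Set (ETerm S ℕ × ETerm S ℕ) :=
  {e | ∃ f ∈ S.oplus,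
    e = (.bin f (.leaf 0) (.leaf 1), .bin f (.leaf 1) (.leaf 0)) ∨
    e = (.bin f (.bin f (.leaf 0) (.leaf 1)) (.leaf 2),
         .bin f (.leaf 0) (.bin f (.leaf 1) (.leaf 2)))}

/-- One replacement, at an arbitrary position of a message, of an instance of the left-hand side
of a pair in `R` by the corresponding instance of the right-hand side. -/
inductive Step (R : Set (ETerm S ℕ × ETerm S ℕ)) : Msg S → Msg S → Prop
  | root {l r : ETerm S ℕ} (h : (l, r) ∈ R) (σ : ℕ → Msg S) : Step R (l.fill σ) (r.fill σ)
  | pub {M M' : Msg S} (h : Step R M M') : Step R (.pub M) (.pub M')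
  | sign₁ {M M' : Msg S} (K : Msg S) (h : Step R M M') : Step R (.sign M K) (.sign M' K)
  | sign₂ (M : Msg S) {K K' : Msg S} (h : Step R K K') : Step R (.sign M K) (.sign M K')
  | blind₁ {M M' : Msg S} (K : Msg S) (h : Step R M M') : Step R (.blind M K) (.blind M' K)
  | blind₂ (M : Msg S) {K K' : Msg S} (h : Step R K K') : Step R (.blind M K) (.blind M K')
  | pair₁ {M M' : Msg S} (N : Msg S) (h : Step R M M') : Step R (.pair M N) (.pair M' N)
  | pair₂ (M : Msg S) {N N' : Msg S} (h : Step R N N') : Step R (.pair M N) (.pair M N')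
  | enc₁ {M M' : Msg S} (K : Msg S) (h : Step R M M') : Step R (.enc M K) (.enc M' K)
  | enc₂ (M : Msg S) {K K' : Msg S} (h : Step R K K') : Step R (.enc M K) (.enc M K')
  | app (f : S.Sym) (args : Fin (S.arity f) → Msg S) (i : Fin (S.arity f)) {N : Msg S}
      (h : Step R (args i) N) : Step R (.app f args) (.app f (Function.update args i N))

/-- The equational theory (on messages) axiomatised by a set of equations. -/
def EqMod (E : Set (ETerm S ℕ × ETerm S ℕ)) : Msg S → Msg S → Prop :=
  Relation.EqvGen (Step E)

/-- Equality modulo associativity and commutativity of the distinguished symbol. -/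
def ACEq : Msg S → Msg S → Prop :=
  EqMod (acEqns S)

/-- Equality modulo the theory `E`, in which the distinguished symbol is AC. -/
def EqE (E : Set (ETerm S ℕ × ETerm S ℕ)) : Msg S → Msg S → Prop :=
  EqMod (E ∪ acEqns S)

/-- One step of rewriting modulo AC. -/
def RewriteAC (R : Set (ETerm S ℕ × ETerm S ℕ)) (M N : Msg S) : Prop :=
  ∃ M' N', ACEq M M' ∧ Step R M' N' ∧ ACEq N' N

/-- The message `M` is in normal form for rewriting modulo AC. -/
def IsNormal (R : Set (ETerm S ℕ × ETerm S ℕ)) (M : Msg S) : Prop :=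
  ∀ N, ¬ RewriteAC R M N

/-- The set `R` of rewrite rules is convergent (terminating and confluent) modulo AC, and
represents the equational theory `E`. -/
structure ACConvergent (E R : Set (ETerm S ℕ × ETerm S ℕ)) : Prop where
  vars_subset : ∀ l r, (l, r) ∈ R → r.vars ⊆ l.vars
  represents : ∀ M N : Msg S, EqE E M N ↔ EqE R M N
  terminating : WellFounded (fun N M : Msg S => RewriteAC R M N)
  confluent : ∀ M N₁ N₂ : Msg S,
    Relation.ReflTransGen (RewriteAC R) M N₁ → Relation.ReflTransGen (RewriteAC R) M N₂ →
    ∃ P₁ P₂, Relation.ReflTransGen (RewriteAC R) N₁ P₁ ∧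
      Relation.ReflTransGen (RewriteAC R) N₂ P₂ ∧ ACEq P₁ P₂

/-- The first message is an immediate subterm of the second. -/
inductive ImmSubterm : Msg S → Msg S → Prop
  | pub (M : Msg S) : ImmSubterm M (.pub M)
  | sign₁ (M K : Msg S) : ImmSubterm M (.sign M K)
  | sign₂ (M K : Msg S) : ImmSubterm K (.sign M K)
  | blind₁ (M K : Msg S) : ImmSubterm M (.blind M K)
  | blind₂ (M K : Msg S) : ImmSubterm K (.blind M K)
  | pair₁ (M N : Msg S) : ImmSubterm M (.pair M N)
  | pair₂ (M N : Msg S) : ImmSubterm N (.pair M N)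
  | enc₁ (M K : Msg S) : ImmSubterm M (.enc M K)
  | enc₂ (M K : Msg S) : ImmSubterm K (.enc M K)
  | app (f : S.Sym) (args : Fin (S.arity f) → Msg S) (i : Fin (S.arity f)) :
      ImmSubterm (args i) (.app f args)

/-- The first message is a (not necessarily proper) subterm of the second. -/
def Subterm : Msg S → Msg S → Prop :=
  Relation.ReflTransGen ImmSubterm

/-- The message is headed by a constructor, that is, by a function symbol not in the signature of
the equational theory (names and variables are not headed by a function symbol). -/
def Msg.Alien : Msg S → Prop
  | .name _ => False
  | .var _ => False
  | .pub _ => True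
  | .sign _ _ => True
  | .blind _ _ => True
  | .pair _ _ => True
  | .enc _ _ => True
  | .app _ _ => False

/-- `A` is a factor of `N`: an alien immediate subterm of a subterm of `N` that is headed by a
symbol of the equational theory. -/
def IsFactor (A N : Msg S) : Prop :=
  A.Alien ∧ ∃ (f : S.Sym) (args : Fin (S.arity f) → Msg S),
    Subterm (.app f args) N ∧ ImmSubterm A (.app f args)

/-- A sequent `Γ ⊢ M`. -/
structure Sequent (S : Signature.{u}) where
  ctx : Set (Msg S)
  goal : Msg S

/-- A sequent that consists of ground messages in normal form. -/
def Sequent.GroundNormal (R : Set (ETerm S ℕ × ETerm S ℕ)) (s : Sequent S) : Prop :=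
  (∀ M ∈ s.ctx, M.Ground ∧ IsNormal R M) ∧ s.goal.Ground ∧ IsNormal R s.goal

/-- The names of the inference rules of the sequent system. -/
inductive Rule
  | id | cut | pL | pR | eL | eR | signL | signR | blindL1 | blindR | blindL2 | acut

/-- `RuleInst E ρ ps c`: the sequents `ps` are the premises and `c` is the conclusion of an
instance of the rule `ρ`. Since the left-hand sides are sets and the left rules keep their
principal messages, `Γ, A` in a conclusion is expressed by `A ∈ Γ`. -/
inductive RuleInst (E : Set (ETerm S ℕ × ETerm S ℕ)) :
    Rule → List (Sequent S) → Sequent S → Prop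
  | id {Γ : Set (Msg S)} {M : Msg S} {k : ℕ} (C : ETerm S (Fin k)) (Ms : Fin k → Msg S)
      (hΓ : ∀ i, Ms i ∈ Γ) (hM : EqE E M (C.fill Ms)) :
      RuleInst E .id [] ⟨Γ, M⟩
  | cut (Γ : Set (Msg S)) (M T : Msg S) :
      RuleInst E .cut [⟨Γ, M⟩, ⟨insert M Γ, T⟩] ⟨Γ, T⟩
  | pL {Γ : Set (Msg S)} {M N : Msg S} (T : Msg S) (h : .pair M N ∈ Γ) :
      RuleInst E .pL [⟨insert M (insert N Γ), T⟩] ⟨Γ, T⟩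
  | pR (Γ : Set (Msg S)) (M N : Msg S) :
      RuleInst E .pR [⟨Γ, M⟩, ⟨Γ, N⟩] ⟨Γ, .pair M N⟩
  | eL {Γ : Set (Msg S)} {M K : Msg S} (N : Msg S) (h : .enc M K ∈ Γ) :
      RuleInst E .eL [⟨Γ, K⟩, ⟨insert M (insert K Γ), N⟩] ⟨Γ, N⟩
  | eR (Γ : Set (Msg S)) (M K : Msg S) :
      RuleInst E .eR [⟨Γ, M⟩, ⟨Γ, K⟩] ⟨Γ, .enc M K⟩
  | signL {Γ : Set (Msg S)} {M K L : Msg S} (N : Msg S) (h : .sign M K ∈ Γ) (h' : .pub L ∈ Γ)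
      (hKL : ACEq K L) :
      RuleInst E .signL [⟨insert M Γ, N⟩] ⟨Γ, N⟩
  | signR (Γ : Set (Msg S)) (M K : Msg S) :
      RuleInst E .signR [⟨Γ, M⟩, ⟨Γ, K⟩] ⟨Γ, .sign M K⟩
  | blindL1 {Γ : Set (Msg S)} {M K : Msg S} (N : Msg S) (h : .blind M K ∈ Γ) :
      RuleInst E .blindL1 [⟨Γ, K⟩, ⟨insert M (insert K Γ), N⟩] ⟨Γ, N⟩
  | blindR (Γ : Set (Msg S)) (M K : Msg S) :
      RuleInst E .blindR [⟨Γ, M⟩, ⟨Γ, K⟩] ⟨Γ, .blind M K⟩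
  | blindL2 {Γ : Set (Msg S)} {M R K : Msg S} (N : Msg S) (h : .sign (.blind M R) K ∈ Γ) :
      RuleInst E .blindL2 [⟨Γ, R⟩, ⟨insert (.sign M K) (insert R Γ), N⟩] ⟨Γ, N⟩
  | acut {Γ : Set (Msg S)} {M A : Msg S} (h : ∃ N ∈ insert M Γ, IsFactor A N) :
      RuleInst E .acut [⟨Γ, A⟩, ⟨insert A Γ, M⟩] ⟨Γ, M⟩

/-- Derivability using only rules from the set `rules`. Every sequent that occurs in a derivation
consists of ground messages in normal form. -/
inductive Derivable (E R : Set (ETerm S ℕ × ETerm S ℕ)) (rules : Set Rule) : Sequent S → Prop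
  | infer {ρ : Rule} {ps : List (Sequent S)} {c : Sequent S} (hρ : ρ ∈ rules)
      (hinst : RuleInst E ρ ps c) (hc : c.GroundNormal R)
      (hps : ∀ p ∈ ps, Derivable E R rules p) : Derivable E R rules c

/-- The rule `ρ` is admissible: every sequent derivable in the full system has a derivation
without instances of `ρ`. -/
def Admissible (E R : Set (ETerm S ℕ × ETerm S ℕ)) (ρ : Rule) : Prop :=
  ∀ s : Sequent S, Derivable E R Set.univ s → Derivable E R {ρ}ᶜ s

end Intruder

namespace Intruder

universe u

variable {S : Signature.{u}}

/-! ### Equality modulo a set of equations -/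

/-! Derivations are moved to the system `CutFree`, which groups the left rules in `Decompose` and
the binary right rules in `IsBinary`. This system is closed under cut (`cutOn`), by induction on the
size of the cut message `M`, then on the derivation of the left premise, then on that of the right
premise (`CutFree.cut_right`). A right rule against a left rule reduces to smaller cuts, and an
analytic cut whose formula is a factor of `M` becomes an ordinary cut on a smaller message.

The equational theory matters where `M` meets `id`. Let `M` be headed by a constructor. If it occurs
in the sequent up to AC, as the goal, a hypothesis or a factor of one of them, the cut is an
instance of `acut` or is superfluous (`CutFree.cut_alienIn`). If it does not, `abstractAlien`
replaces it in the instance of `id` by some `x` built from the context: equations do not see inside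
constructors, so equality modulo `E` survives, and normal messages in which `M` does not occur are
unchanged (`CutFree.cut_right_id`). The same abstraction shows that a constructor-headed `M`
obtained by `id` must occur in the context, since otherwise it would equal every message. If `M`
comes from `id` and is not headed by a constructor, contexts compose and no left rule can decompose
`M`.

Normal messages equal modulo `E` are equal modulo AC, so it remains to know that derivability is
stable under AC (`CutFree.acEq`); this requires factors to be AC-invariant. -/

theorem EqMod.refl {E : Set (ETerm S ℕ × ETerm S ℕ)} (M : Msg S) : EqMod E M M :=
  Relation.EqvGen.refl M

theorem EqMod.symm {E : Set (ETerm S ℕ × ETerm S ℕ)} {M N : Msg S} (h : EqMod E M N) :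
    EqMod E N M :=
  Relation.EqvGen.symm _ _ h

theorem EqMod.trans {E : Set (ETerm S ℕ × ETerm S ℕ)} {M N P : Msg S} (h : EqMod E M N)
    (h' : EqMod E N P) : EqMod E M P :=
  Relation.EqvGen.trans _ _ _ h h'

theorem EqMod.of_step {E : Set (ETerm S ℕ × ETerm S ℕ)} {M N : Msg S} (h : Step E M N) :
    EqMod E M N :=
  Relation.EqvGen.rel _ _ h

/-- An equivalence relation that contains one-step replacement contains equality modulo. -/
theorem EqMod.le_of_equivalence {E : Set (ETerm S ℕ × ETerm S ℕ)} {r : Msg S → Msg S → Prop}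
    (hr : Equivalence r) (hs : ∀ M N, Step E M N → r M N) {M N : Msg S} (h : EqMod E M N) :
    r M N := by
  induction h with
  | rel _ _ h => exact hs _ _ h
  | refl _ => exact hr.refl _
  | symm _ _ _ ih => exact hr.symm ih
  | trans _ _ _ _ _ ih ih' => exact hr.trans ih ih'

theorem Step.mono {E E' : Set (ETerm S ℕ × ETerm S ℕ)} (hE : E ⊆ E') {M N : Msg S}
    (h : Step E M N) : Step E' M N := by
  induction h with
  | root h σ => exact .root (hE h) σ
  | pub _ ih => exact .pub ih
  | sign₁ K _ ih => exact .sign₁ K ih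
  | sign₂ M _ ih => exact .sign₂ M ih
  | blind₁ K _ ih => exact .blind₁ K ih
  | blind₂ M _ ih => exact .blind₂ M ih
  | pair₁ K _ ih => exact .pair₁ K ih
  | pair₂ M _ ih => exact .pair₂ M ih
  | enc₁ K _ ih => exact .enc₁ K ih
  | enc₂ M _ ih => exact .enc₂ M ih
  | app f args i _ ih => exact .app f args i ih

theorem EqMod.map {E E' : Set (ETerm S ℕ × ETerm S ℕ)} (c : Msg S → Msg S)
    (hc : ∀ M N, Step E M N → EqMod E' (c M) (c N)) {M N : Msg S} (h : EqMod E M N) :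
    EqMod E' (c M) (c N) :=
  EqMod.le_of_equivalence (r := fun M N => EqMod E' (c M) (c N))
    ⟨fun _ => .refl _, .symm, .trans⟩ hc h

theorem ACEq.eqE {E : Set (ETerm S ℕ × ETerm S ℕ)} {M N : Msg S} (h : ACEq M N) :
    EqE E M N :=
  EqMod.map id (fun _ _ h => .of_step (h.mono Set.subset_union_right)) h

theorem EqMod.app_update {E : Set (ETerm S ℕ × ETerm S ℕ)} (f : S.Sym)
    (args : Fin (S.arity f) → Msg S) (i : Fin (S.arity f)) {M N : Msg S} (h : EqMod E M N) :
    EqMod E (.app f (Function.update args i M)) (.app f (Function.update args i N)) :=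
  EqMod.map (fun M => .app f (Function.update args i M)) (fun M N h => by
    have := Step.app f (Function.update args i M) i (N := N) (by simpa using h)
    exact .of_step (by simpa using this)) h

theorem EqMod.app {E : Set (ETerm S ℕ × ETerm S ℕ)} (f : S.Sym)
    {args args' : Fin (S.arity f) → Msg S} (h : ∀ i, EqMod E (args i) (args' i)) :
    EqMod E (.app f args) (.app f args') := by
  classical
  -- The arguments are exchanged one at a time; `s` holds the positions already changed.
  have key : ∀ s : Finset (Fin (S.arity f)),
      EqMod E (.app f args) (.app f (s.piecewise args' args)) := by
    intro s
    induction s using Finset.induction_on with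
    | empty => simpa using EqMod.refl _
    | insert i s hi ih =>
      refine ih.trans ?_
      have := EqMod.app_update f (s.piecewise args' args) i (h i)
      rw [Finset.piecewise_insert]
      convert this using 2
      rw [eq_comm, Function.update_eq_self_iff]
      simp [hi]
  simpa using key Finset.univ

/-- An immediate subterm sits in a one-hole context that preserves replacement steps. -/
theorem ImmSubterm.exists_context {A N : Msg S} (h : ImmSubterm A N) :
    ∃ c : Msg S → Msg S, c A = N ∧
      ∀ (R : Set (ETerm S ℕ × ETerm S ℕ)) (B B' : Msg S), Step R B B' → Step R (c B) (c B') := by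
  cases h with
  | pub => exact ⟨_, rfl, fun _ _ _ h => .pub h⟩
  | sign₁ M K => exact ⟨fun M => .sign M K, rfl, fun _ _ _ h => .sign₁ _ h⟩
  | sign₂ M K => exact ⟨_, rfl, fun _ _ _ h => .sign₂ M h⟩
  | blind₁ M K => exact ⟨fun M => .blind M K, rfl, fun _ _ _ h => .blind₁ _ h⟩
  | blind₂ M K => exact ⟨_, rfl, fun _ _ _ h => .blind₂ M h⟩
  | pair₁ M K => exact ⟨fun M => .pair M K, rfl, fun _ _ _ h => .pair₁ _ h⟩
  | pair₂ M K => exact ⟨_, rfl, fun _ _ _ h => .pair₂ M h⟩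
  | enc₁ M K => exact ⟨fun M => .enc M K, rfl, fun _ _ _ h => .enc₁ _ h⟩
  | enc₂ M K => exact ⟨_, rfl, fun _ _ _ h => .enc₂ M h⟩
  | app f args i =>
    refine ⟨fun B => .app f (Function.update args i B), by simp, fun R B B' h => ?_⟩
    have := Step.app (R := R) f (Function.update args i B) i (N := B') (by simpa using h)
    simpa using this

theorem ImmSubterm.isNormal {R : Set (ETerm S ℕ × ETerm S ℕ)} {A N : Msg S}
    (h : ImmSubterm A N) (hN : IsNormal R N) : IsNormal R A := by
  obtain ⟨c, rfl, hc⟩ := h.exists_context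
  rintro B ⟨B₁, B₂, h₁, h₂, h₃⟩
  exact hN (c B) ⟨c B₁, c B₂, EqMod.map c (fun _ _ h => .of_step (hc _ _ _ h)) h₁, hc _ _ _ h₂,
    EqMod.map c (fun _ _ h => .of_step (hc _ _ _ h)) h₃⟩

theorem ACEq.isNormal {R : Set (ETerm S ℕ × ETerm S ℕ)} {M N : Msg S} (h : ACEq M N)
    (hM : IsNormal R M) : IsNormal R N := by
  rintro P ⟨N₁, N₂, h₁, h₂, h₃⟩
  exact hM P ⟨N₁, N₂, EqMod.trans h h₁, h₂, h₃⟩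

/-! ### Structural invariants of equality modulo AC -/

/-- Messages with the same head, with related immediate subterms below constructors. -/
inductive SameHead (r : Msg S → Msg S → Prop) : Msg S → Msg S → Prop
  | name (a) : SameHead r (.name a) (.name a)
  | var (x) : SameHead r (.var x) (.var x)
  | pub {M M'} (h : r M M') : SameHead r (.pub M) (.pub M')
  | sign {M M' K K'} (h : r M M') (h' : r K K') : SameHead r (.sign M K) (.sign M' K')
  | blind {M M' K K'} (h : r M M') (h' : r K K') : SameHead r (.blind M K) (.blind M' K')
  | pair {M M' K K'} (h : r M M') (h' : r K K') : SameHead r (.pair M K) (.pair M' K')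
  | enc {M M' K K'} (h : r M M') (h' : r K K') : SameHead r (.enc M K) (.enc M' K')
  | app (f g args args') : SameHead r (.app f args) (.app g args')

theorem SameHead.equivalence {r : Msg S → Msg S → Prop} (hr : Equivalence r) :
    Equivalence (SameHead r) where
  refl M := by cases M <;> constructor <;> exact hr.refl _
  symm h := by cases h <;> constructor <;> apply hr.symm <;> assumption
  trans h h' := by
    cases h <;> cases h' <;> constructor <;> apply hr.trans <;> assumption

theorem ACEq.equivalence : Equivalence (ACEq (S := S)) :=
  ⟨EqMod.refl, EqMod.symm, EqMod.trans⟩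

/-- Both sides of each AC axiom are headed by the AC symbol, so a step on a constructor-headed
message happens strictly inside it. Nothing is kept about arguments of signature symbols, which AC
may regroup. -/
theorem ACEq.sameHead {M N : Msg S} (h : ACEq M N) : SameHead ACEq M N := by
  refine EqMod.le_of_equivalence (SameHead.equivalence ACEq.equivalence) (fun M N h => ?_) h
  cases h with
  | root h σ =>
    obtain ⟨f, -, h | h⟩ := h <;> cases h <;> exact .app ..
  | app => exact .app ..
  | _ =>
    constructor <;>
      first
      | exact EqMod.refl _
      | exact EqMod.of_step (by assumption)

theorem ACEq.alien {M N : Msg S} (h : ACEq M N) (hM : M.Alien) : N.Alien := by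
  cases h.sameHead <;> trivial

/-- The message `f(s, t)`, for `f` of arity two. -/
def Msg.bin (f : S.Sym) (s t : Msg S) : Msg S :=
  .app f (fun i => if i.val = 0 then s else t)

theorem ETerm.fill_bin {X : Type} (σ : X → Msg S) (f : S.Sym) (s t : ETerm S X) :
    (ETerm.bin f s t).fill σ = Msg.bin f (s.fill σ) (t.fill σ) := by
  simp only [ETerm.bin, ETerm.fill, Msg.bin]
  congr 1
  funext i
  split_ifs <;> rfl

theorem forall_bin {f : S.Sym} (hf : f ∈ S.oplus) {p : Msg S → Prop} {s t : Msg S} :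
    (∀ i : Fin (S.arity f), p (if i.val = 0 then s else t)) ↔ p s ∧ p t := by
  have := S.oplus_arity f hf
  constructor
  · intro h
    exact ⟨by simpa using h ⟨0, by omega⟩, by simpa using h ⟨1, by omega⟩⟩
  · rintro ⟨h, h'⟩ i
    split_ifs <;> assumption

theorem exists_bin {f : S.Sym} (hf : f ∈ S.oplus) {p : Msg S → Prop} {s t : Msg S} :
    (∃ i : Fin (S.arity f), p (if i.val = 0 then s else t)) ↔ p s ∨ p t := by
  have := forall_bin hf (p := fun M => ¬ p M) (s := s) (t := t)
  rw [← not_iff_not]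
  push Not
  exact this

theorem ACEq.ground_iff {M N : Msg S} (h : ACEq M N) : M.Ground ↔ N.Ground := by
  refine EqMod.le_of_equivalence (r := fun M N : Msg S => M.Ground ↔ N.Ground)
    ⟨fun _ => Iff.rfl, Iff.symm, Iff.trans⟩ (fun M N h => ?_) h
  induction h with
  | root h σ =>
    obtain ⟨f, hf, h | h⟩ := h <;> cases h
    all_goals
      have key : ∀ s t : Msg S, (Msg.bin f s t).Ground ↔ s.Ground ∧ t.Ground :=
        fun s t => forall_bin hf
      simp only [ETerm.fill_bin, key]
      tauto
  | app f args i h ih =>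
    simp only [Msg.Ground]
    refine forall_congr' fun j => ?_
    rcases eq_or_ne j i with rfl | hj
    · simpa using ih
    · simp [hj]
  | pub _ ih => exact ih
  | sign₁ _ _ ih => exact and_congr_left' ih
  | sign₂ _ _ ih => exact and_congr_right' ih
  | blind₁ _ _ ih => exact and_congr_left' ih
  | blind₂ _ _ ih => exact and_congr_right' ih
  | pair₁ _ _ ih => exact and_congr_left' ih
  | pair₂ _ _ ih => exact and_congr_right' ih
  | enc₁ _ _ ih => exact and_congr_left' ih
  | enc₂ _ _ ih => exact and_congr_right' ih

/-! ### Factors modulo AC -/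

/-- `A` is a factor of `N` up to AC. -/
def FactorAC (A N : Msg S) : Prop :=
  ∃ A', ACEq A A' ∧ IsFactor A' N

theorem isFactor_iff {A N : Msg S} : IsFactor A N ↔
    (A.Alien ∧ ∃ f args, N = .app f args ∧ ImmSubterm A N) ∨
      ∃ N', ImmSubterm N' N ∧ IsFactor A N' := by
  constructor
  · rintro ⟨hA, f, args, hs, hi⟩
    rcases hs.cases_tail with rfl | ⟨N', h₁, h₂⟩
    · exact .inl ⟨hA, _, _, rfl, hi⟩
    · exact .inr ⟨N', h₂, hA, f, args, h₁, hi⟩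
  · rintro (⟨hA, f, args, rfl, hi⟩ | ⟨N', h, hA, f, args, hs, hi⟩)
    · exact ⟨hA, f, args, .refl, hi⟩
    · exact ⟨hA, f, args, hs.tail h, hi⟩

theorem factorAC_iff {A N : Msg S} : FactorAC A N ↔
    (A.Alien ∧ ∃ f args, N = .app f args ∧ ∃ B, ACEq A B ∧ ImmSubterm B N) ∨
      ∃ N', ImmSubterm N' N ∧ FactorAC A N' := by
  constructor
  · rintro ⟨A', h, h'⟩
    rcases isFactor_iff.1 h' with ⟨hA, f, args, rfl, hi⟩ | ⟨N', hi, hN'⟩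
    · exact .inl ⟨ACEq.alien h.symm hA, f, args, rfl, A', h, hi⟩
    · exact .inr ⟨N', hi, A', h, hN'⟩
  · rintro (⟨hA, f, args, rfl, B, h, hi⟩ | ⟨N', hi, A', h, hN'⟩)
    · exact ⟨B, h, isFactor_iff.2 (.inl ⟨h.alien hA, f, args, rfl, hi⟩)⟩
    · exact ⟨A', h, isFactor_iff.2 (.inr ⟨N', hi, hN'⟩)⟩

/-- `A` is, up to AC, an alien message that is a factor of `f(…, N, …)`. -/
def AlienIn (A N : Msg S) : Prop :=
  (A.Alien ∧ ACEq A N) ∨ FactorAC A N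

theorem factorAC_app {A : Msg S} {f : S.Sym} {args : Fin (S.arity f) → Msg S} :
    FactorAC A (.app f args) ↔ ∃ i, AlienIn A (args i) := by
  rw [factorAC_iff]
  constructor
  · rintro (⟨hA, _, _, -, B, h, hi⟩ | ⟨N', hi, h⟩)
    · cases hi with | app _ _ i => exact ⟨i, .inl ⟨hA, h⟩⟩
    · cases hi with | app _ _ i => exact ⟨i, .inr h⟩
  · rintro ⟨i, ⟨hA, h⟩ | h⟩
    · exact .inl ⟨hA, f, args, rfl, _, h, .app f args i⟩
    · exact .inr ⟨_, .app f args i, h⟩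

theorem factorAC_pub {A M : Msg S} : FactorAC A (.pub M) ↔ FactorAC A M := by
  rw [factorAC_iff]
  constructor
  · rintro (⟨-, _, _, h, -⟩ | ⟨N', hi, h⟩)
    · cases h
    · cases hi; exact h
  · exact fun h => .inr ⟨_, .pub _, h⟩

theorem factorAC_sign {A M K : Msg S} :
    FactorAC A (.sign M K) ↔ FactorAC A M ∨ FactorAC A K := by
  rw [factorAC_iff]
  constructor
  · rintro (⟨-, _, _, h, -⟩ | ⟨N', hi, h⟩)
    · cases h
    · cases hi <;> simp [h]
  · exact fun h => .inr (h.elim (fun h => ⟨_, .sign₁ _ _, h⟩) fun h => ⟨_, .sign₂ _ _, h⟩)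

theorem factorAC_blind {A M K : Msg S} :
    FactorAC A (.blind M K) ↔ FactorAC A M ∨ FactorAC A K := by
  rw [factorAC_iff]
  constructor
  · rintro (⟨-, _, _, h, -⟩ | ⟨N', hi, h⟩)
    · cases h
    · cases hi <;> simp [h]
  · exact fun h => .inr (h.elim (fun h => ⟨_, .blind₁ _ _, h⟩) fun h => ⟨_, .blind₂ _ _, h⟩)

theorem factorAC_pair {A M K : Msg S} :
    FactorAC A (.pair M K) ↔ FactorAC A M ∨ FactorAC A K := by
  rw [factorAC_iff]
  constructor
  · rintro (⟨-, _, _, h, -⟩ | ⟨N', hi, h⟩)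
    · cases h
    · cases hi <;> simp [h]
  · exact fun h => .inr (h.elim (fun h => ⟨_, .pair₁ _ _, h⟩) fun h => ⟨_, .pair₂ _ _, h⟩)

theorem factorAC_enc {A M K : Msg S} :
    FactorAC A (.enc M K) ↔ FactorAC A M ∨ FactorAC A K := by
  rw [factorAC_iff]
  constructor
  · rintro (⟨-, _, _, h, -⟩ | ⟨N', hi, h⟩)
    · cases h
    · cases hi <;> simp [h]
  · exact fun h => .inr (h.elim (fun h => ⟨_, .enc₁ _ _, h⟩) fun h => ⟨_, .enc₂ _ _, h⟩)

theorem alienIn_app {A : Msg S} {f : S.Sym} {args : Fin (S.arity f) → Msg S} :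
    AlienIn A (.app f args) ↔ FactorAC A (.app f args) := by
  refine ⟨?_, .inr⟩
  rintro (⟨hA, h⟩ | h)
  · exact (h.alien hA).elim
  · exact h

/-- A nested AC symbol is transparent for factors: those of a sum come from its summands, however
they are bracketed or ordered. Hence an analytic cut stays analytic after AC replacement. -/
theorem ACEq.factorAC_iff {A M N : Msg S} (h : ACEq M N) : FactorAC A M ↔ FactorAC A N := by
  refine EqMod.le_of_equivalence (r := fun M N : Msg S => FactorAC A M ↔ FactorAC A N)
    ⟨fun _ => Iff.rfl, Iff.symm, Iff.trans⟩ (fun M N h => ?_) h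
  induction h with
  | root h σ =>
    obtain ⟨f, hf, h | h⟩ := h <;> cases h
    all_goals
      have key : ∀ s t : Msg S, FactorAC A (Msg.bin f s t) ↔ AlienIn A s ∨ AlienIn A t :=
        fun s t => factorAC_app.trans (exists_bin hf)
      have key' : ∀ s t : Msg S, AlienIn A (Msg.bin f s t) ↔ AlienIn A s ∨ AlienIn A t :=
        fun s t => alienIn_app.trans (key s t)
      simp only [ETerm.fill_bin, key, key']
      tauto
  | app f args i h ih =>
    simp only [factorAC_app]
    refine exists_congr fun j => ?_
    rcases eq_or_ne j i with rfl | hj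
    · have hst : ACEq (args j) _ := EqMod.of_step h
      simp only [AlienIn, Function.update_self, ih]
      exact or_congr_left (and_congr_right fun _ =>
        ⟨fun h' => h'.trans hst, fun h' => h'.trans hst.symm⟩)
    · simp [hj]
  | pub _ ih => simpa only [factorAC_pub] using ih
  | sign₁ _ _ ih => simp only [factorAC_sign, ih]
  | sign₂ _ _ ih => simp only [factorAC_sign, ih]
  | blind₁ _ _ ih => simp only [factorAC_blind, ih]
  | blind₂ _ _ ih => simp only [factorAC_blind, ih]
  | pair₁ _ _ ih => simp only [factorAC_pair, ih]
  | pair₂ _ _ ih => simp only [factorAC_pair, ih]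
  | enc₁ _ _ ih => simp only [factorAC_enc, ih]
  | enc₂ _ _ ih => simp only [factorAC_enc, ih]

/-! ### Size -/

/-- The number of symbols of a message. -/
def Msg.size : Msg S → ℕ
  | .name _ => 1
  | .var _ => 1
  | .pub M => M.size + 1
  | .sign M K => M.size + K.size + 1
  | .blind M K => M.size + K.size + 1
  | .pair M K => M.size + K.size + 1
  | .enc M K => M.size + K.size + 1
  | .app _ args => (∑ i, (args i).size) + 1

theorem ImmSubterm.size_lt {A N : Msg S} (h : ImmSubterm A N) : A.size < N.size := by
  cases h with
  | app f args i =>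
    have := Finset.single_le_sum (f := fun i => (args i).size) (fun _ _ => Nat.zero_le _)
      (Finset.mem_univ i)
    simp only [Msg.size] at *
    omega
  | _ => simp only [Msg.size]; omega

theorem Subterm.size_le {A N : Msg S} (h : Subterm A N) : A.size ≤ N.size := by
  induction h with
  | refl => rfl
  | tail _ h ih => exact ih.trans h.size_lt.le

theorem IsFactor.size_lt {A N : Msg S} (h : IsFactor A N) : A.size < N.size := by
  obtain ⟨-, f, args, hs, hi⟩ := h
  exact hi.size_lt.trans_le hs.size_le

/-! ### Unique normal forms -/

/-- A rewrite step absorbs AC on its left, so the first step takes up the discrepancy; without any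
step it remains at the end. -/
theorem ACEq.reflTransGen_rewriteAC {R : Set (ETerm S ℕ × ETerm S ℕ)} {P Q W : Msg S}
    (h : ACEq P Q) (hQ : Relation.ReflTransGen (RewriteAC R) Q W) :
    ∃ W', Relation.ReflTransGen (RewriteAC R) P W' ∧ ACEq W' W := by
  rcases hQ.cases_head with rfl | ⟨Q', ⟨Q₁, Q₂, h₁, h₂, h₃⟩, hW⟩
  · exact ⟨P, .refl, h⟩
  · exact ⟨W, hW.head ⟨Q₁, Q₂, h.trans h₁, h₂, h₃⟩, .refl _⟩

/-- The Church–Rosser property: joinability modulo AC is an equivalence, with confluence giving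
transitivity. -/
theorem ACConvergent.join {E R : Set (ETerm S ℕ × ETerm S ℕ)} (h : ACConvergent E R)
    {M N : Msg S} (hMN : EqE E M N) :
    ∃ P Q, Relation.ReflTransGen (RewriteAC R) M P ∧ Relation.ReflTransGen (RewriteAC R) N Q ∧
      ACEq P Q := by
  refine EqMod.le_of_equivalence (r := fun M N : Msg S => ∃ P Q,
    Relation.ReflTransGen (RewriteAC R) M P ∧ Relation.ReflTransGen (RewriteAC R) N Q ∧
      ACEq P Q) ⟨fun M => ⟨M, M, .refl, .refl, .refl _⟩, ?_, ?_⟩ (fun M N hs => ?_)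
      ((h.represents M N).1 hMN)
  · rintro M N ⟨P, Q, h₁, h₂, h₃⟩
    exact ⟨Q, P, h₂, h₁, h₃.symm⟩
  · rintro M N L ⟨P₁, P₂, h₁, h₂, h₃⟩ ⟨Q₁, Q₂, h₁', h₂', h₃'⟩
    obtain ⟨W₁, W₂, hW₁, hW₂, hW⟩ := h.confluent N P₂ Q₁ h₂ h₁'
    obtain ⟨V₁, hV₁, hV₁'⟩ := h₃.reflTransGen_rewriteAC hW₁
    obtain ⟨V₂, hV₂, hV₂'⟩ := ACEq.reflTransGen_rewriteAC h₃'.symm hW₂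
    exact ⟨V₁, V₂, h₁.trans hV₁, h₂'.trans hV₂, (hV₁'.trans hW).trans hV₂'.symm⟩
  · have : Step R M N ∨ Step (acEqns S) M N := by
      clear hMN
      induction hs with
      | root h σ => exact h.imp (.root · σ) (.root · σ)
      | pub _ ih => exact ih.imp .pub .pub
      | sign₁ K _ ih => exact ih.imp (.sign₁ K) (.sign₁ K)
      | sign₂ M _ ih => exact ih.imp (.sign₂ M) (.sign₂ M)
      | blind₁ K _ ih => exact ih.imp (.blind₁ K) (.blind₁ K)
      | blind₂ M _ ih => exact ih.imp (.blind₂ M) (.blind₂ M)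
      | pair₁ K _ ih => exact ih.imp (.pair₁ K) (.pair₁ K)
      | pair₂ M _ ih => exact ih.imp (.pair₂ M) (.pair₂ M)
      | enc₁ K _ ih => exact ih.imp (.enc₁ K) (.enc₁ K)
      | enc₂ M _ ih => exact ih.imp (.enc₂ M) (.enc₂ M)
      | app f args i _ ih => exact ih.imp (.app f args i) (.app f args i)
    rcases this with hs | hs
    · exact ⟨N, N, .single ⟨M, N, .refl _, hs, .refl _⟩, .refl, .refl _⟩
    · exact ⟨M, N, .refl, .refl, .of_step hs⟩

theorem IsNormal.eq_of_reflTransGen {R : Set (ETerm S ℕ × ETerm S ℕ)} {M P : Msg S}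
    (hM : IsNormal R M) (h : Relation.ReflTransGen (RewriteAC R) M P) : M = P := by
  rcases h.cases_head with h | ⟨Q, h, -⟩
  · exact h
  · exact (hM Q h).elim

theorem ACConvergent.acEq_of_isNormal {E R : Set (ETerm S ℕ × ETerm S ℕ)}
    (h : ACConvergent E R) {M N : Msg S} (hM : IsNormal R M) (hN : IsNormal R N)
    (hMN : EqE E M N) : ACEq M N := by
  obtain ⟨P, Q, h₁, h₂, h₃⟩ := h.join hMN
  rwa [hM.eq_of_reflTransGen h₁, hN.eq_of_reflTransGen h₂]

/-- If some message is normal, then all names are. -/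
theorem IsNormal.name {R : Set (ETerm S ℕ × ETerm S ℕ)} {M : Msg S} (hM : IsNormal R M)
    (a : ℕ) : IsNormal R (.name a) := by
  rintro P ⟨N₁, N₂, h₁, h₂, -⟩
  cases h₁.sameHead
  generalize hN : Msg.name a = N at h₂
  cases h₂ with
  | @root l r hR σ =>
    cases l with
    -- A rule whose left-hand side is a variable would rewrite every message, including the normal
    -- `M`.
    | leaf x => exact hM _ ⟨M, _, .refl _, Step.root hR fun _ => M, .refl _⟩
    | app f args => cases hN
  | _ => cases hN

theorem ACConvergent.not_eqE_names {E R : Set (ETerm S ℕ × ETerm S ℕ)}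
    (h : ACConvergent E R) {M : Msg S} (hM : IsNormal R M) :
    ¬ EqE E (Msg.name 0 : Msg S) (.name 1) := by
  intro h01
  cases (h.acEq_of_isNormal (hM.name 0) (hM.name 1) h01).sameHead

/-! ### Abstraction of an alien message -/

open Classical in
/-- Replace by `x` the aliens equal to `M` modulo `E` that occur in a message below symbols of
the signature only. -/
noncomputable def abstractAlien (E : Set (ETerm S ℕ × ETerm S ℕ)) (M x : Msg S) : Msg S → Msg S
  | .app f args => .app f (fun i => abstractAlien E M x (args i))
  | N => if N.Alien ∧ EqE E N M then x else N

open Classical in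
theorem abstr_of_alien {E : Set (ETerm S ℕ × ETerm S ℕ)} {M x N : Msg S} (hN : N.Alien) :
    abstractAlien E M x N = if EqE E N M then x else N := by
  cases N <;> simp_all [abstractAlien, Msg.Alien]

/-- Terms of the theory contain no constructors, so abstraction acts only on the substitution;
instances of equations go to instances of equations. -/
theorem ETerm.abstr_fill {E : Set (ETerm S ℕ × ETerm S ℕ)} {M x : Msg S} {X : Type}
    (σ : X → Msg S) (t : ETerm S X) :
    abstractAlien E M x (t.fill σ) = t.fill fun i => abstractAlien E M x (σ i) := by
  induction t with
  | leaf i => rfl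
  | app f args ih => simp [ETerm.fill, abstractAlien, ih]

theorem eqE_abstr_of_alien {E : Set (ETerm S ℕ × ETerm S ℕ)} {M x P Q : Msg S} (hP : P.Alien)
    (hQ : Q.Alien) (h : EqE E P Q) : EqE E (abstractAlien E M x P) (abstractAlien E M x Q) := by
  rw [abstr_of_alien hP, abstr_of_alien hQ]
  by_cases hPM : EqE E P M
  · rw [if_pos hPM, if_pos (show EqE E Q M from h.symm.trans hPM)]
    exact .refl _
  · rw [if_neg hPM, if_neg fun hQM : EqE E Q M => hPM (h.trans hQM)]
    exact h

/-- A step below signature symbols only is an instance of `ETerm.abstr_fill`. A step inside an alien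
keeps its class modulo `E`, so the alien is replaced both before and after or not at all; this is
why the replacement test is modulo `E`. -/
theorem EqE.abstr {E : Set (ETerm S ℕ × ETerm S ℕ)} (M x : Msg S) {P Q : Msg S}
    (h : EqE E P Q) : EqE E (abstractAlien E M x P) (abstractAlien E M x Q) := by
  refine EqMod.map (abstractAlien E M x) (fun P Q h => ?_) h
  induction h with
  | root h σ =>
    rw [ETerm.abstr_fill, ETerm.abstr_fill]
    exact .of_step (.root h _)
  | app f args i h ih =>
    refine EqMod.app f fun j => ?_
    rcases eq_or_ne j i with rfl | hj
    · simpa using ih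
    · simpa [hj] using EqMod.refl _
  | pub h => exact eqE_abstr_of_alien trivial trivial (.of_step (.pub h))
  | sign₁ K h => exact eqE_abstr_of_alien trivial trivial (.of_step (.sign₁ K h))
  | sign₂ K h => exact eqE_abstr_of_alien trivial trivial (.of_step (.sign₂ K h))
  | blind₁ K h => exact eqE_abstr_of_alien trivial trivial (.of_step (.blind₁ K h))
  | blind₂ K h => exact eqE_abstr_of_alien trivial trivial (.of_step (.blind₂ K h))
  | pair₁ K h => exact eqE_abstr_of_alien trivial trivial (.of_step (.pair₁ K h))
  | pair₂ K h => exact eqE_abstr_of_alien trivial trivial (.of_step (.pair₂ K h))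
  | enc₁ K h => exact eqE_abstr_of_alien trivial trivial (.of_step (.enc₁ K h))
  | enc₂ K h => exact eqE_abstr_of_alien trivial trivial (.of_step (.enc₂ K h))

theorem abstr_self {E : Set (ETerm S ℕ × ETerm S ℕ)} {M x : Msg S} (hM : M.Alien) :
    abstractAlien E M x M = x := by
  rw [abstr_of_alien hM, if_pos (show EqE E M M from .refl _)]

/-- By uniqueness of normal forms, an alien that gets replaced is AC-equal to `M`, so `M` would
occur in `N`. -/
theorem ACConvergent.abstr_eq_self {E R : Set (ETerm S ℕ × ETerm S ℕ)} (h : ACConvergent E R)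
    {M x : Msg S} (hM : IsNormal R M) {N : Msg S} (hN : IsNormal R N)
    (hMN : ¬ AlienIn M N) : abstractAlien E M x N = N := by
  have alien : ∀ N : Msg S, N.Alien → IsNormal R N → ¬ AlienIn M N → abstractAlien E M x N = N := by
    intro N hA hN hMN
    rw [abstr_of_alien hA, if_neg]
    intro hE
    have hac := h.acEq_of_isNormal hN hM hE
    exact hMN (.inl ⟨hac.alien hA, hac.symm⟩)
  induction N with
  | app f args ih =>
    simp only [abstractAlien]
    congr 1
    funext i
    exact ih i ((ImmSubterm.app f args i).isNormal hN) fun hi =>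
      hMN (.inr (factorAC_app.2 ⟨i, hi⟩))
  | name => simp [abstractAlien, Msg.Alien]
  | var => simp [abstractAlien, Msg.Alien]
  | _ => exact alien _ trivial hN hMN

/-! ### Messages built from a set by symbols of the signature -/

/-- `Built Γ N`: the message `N` is obtained from members of `Γ` by symbols of the signature. -/
inductive Built (Γ : Set (Msg S)) : Msg S → Prop
  | mem {M : Msg S} (h : M ∈ Γ) : Built Γ M
  | app (f : S.Sym) (args : Fin (S.arity f) → Msg S) (h : ∀ i, Built Γ (args i)) :
      Built Γ (.app f args)

theorem ETerm.built_fill {Γ : Set (Msg S)} {X : Type} (C : ETerm S X) {σ : X → Msg S}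
    (hσ : ∀ i, σ i ∈ Γ) : Built Γ (C.fill σ) := by
  induction C with
  | leaf i => exact .mem (hσ i)
  | app f args ih => exact .app f _ ih

/-- Rename the leaves of a term. -/
def ETerm.map {X Y : Type} (g : X → Y) : ETerm S X → ETerm S Y
  | .leaf x => .leaf (g x)
  | .app f args => .app f (fun i => (args i).map g)

theorem ETerm.fill_map {X Y : Type} (g : X → Y) (σ : Y → Msg S) (t : ETerm S X) :
    (t.map g).fill σ = t.fill (σ ∘ g) := by
  induction t with
  | leaf x => rfl
  | app f args ih => simp [ETerm.map, ETerm.fill, ih]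

theorem Built.exists_context {Γ : Set (Msg S)} {N : Msg S} (h : Built Γ N) :
    ∃ (k : ℕ) (C : ETerm S (Fin k)) (Ms : Fin k → Msg S), (∀ i, Ms i ∈ Γ) ∧ C.fill Ms = N := by
  induction h with
  | @mem M h => exact ⟨1, .leaf 0, fun _ => M, fun _ => h, rfl⟩
  | app f args _ ih =>
    choose k C Ms hMs hC using ih
    -- The holes of all arguments are numbered consecutively to form a single context.
    let e := finSigmaFinEquiv (n := k)
    refine ⟨_, .app f fun i => (C i).map fun j => e ⟨i, j⟩,
      fun j => Ms (e.symm j).1 (e.symm j).2, fun j => hMs _ _, ?_⟩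
    simp only [ETerm.fill, ETerm.fill_map]
    congr 1
    funext i
    rw [← hC i]
    congr 1
    funext j
    change Ms (e.symm (e ⟨i, j⟩)).1 (e.symm (e ⟨i, j⟩)).2 = _
    rw [e.symm_apply_apply]

theorem Built.bind {E : Set (ETerm S ℕ × ETerm S ℕ)} {Γ Δ : Set (Msg S)}
    (hΓ : ∀ P ∈ Γ, ∃ N, EqE E P N ∧ Built Δ N) {N : Msg S} (h : Built Γ N) :
    ∃ N', EqE E N N' ∧ Built Δ N' := by
  induction h with
  | mem h => exact hΓ _ h
  | app f args _ ih =>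
    choose N' h₁ h₂ using ih
    exact ⟨_, EqMod.app f h₁, .app f _ h₂⟩

theorem Built.abstr {E : Set (ETerm S ℕ × ETerm S ℕ)} {M x : Msg S} {Γ Δ : Set (Msg S)}
    (hΓ : ∀ P ∈ Γ, Built Δ (abstractAlien E M x P)) {N : Msg S} (h : Built Γ N) :
    Built Δ (abstractAlien E M x N) := by
  induction h with
  | mem h => exact hΓ _ h
  | app f args _ ih => exact .app f _ ih

theorem Built.abstr_eq_self {E : Set (ETerm S ℕ × ETerm S ℕ)} {M x : Msg S} {Γ : Set (Msg S)}
    (hΓ : ∀ P ∈ Γ, abstractAlien E M x P = P) {N : Msg S} (h : Built Γ N) : abstractAlien E M x N = N := by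
  induction h with
  | mem h => exact hΓ _ h
  | app f args _ ih => simp [abstractAlien, ih]

/-- An alien normal message built modulo `E` from normal messages occurs in one of them. -/
theorem ACConvergent.exists_alienIn_of_built {E R : Set (ETerm S ℕ × ETerm S ℕ)}
    (h : ACConvergent E R) {Γ : Set (Msg S)} (hΓ : ∀ P ∈ Γ, IsNormal R P) {M N : Msg S}
    (hM : IsNormal R M) (hA : M.Alien) (hMN : EqE E M N) (hN : Built Γ N) :
    ∃ P ∈ Γ, AlienIn M P := by
  by_contra! hcon
  -- If `M` occurs nowhere, abstraction fixes `N` and sends `M` to an arbitrary `x`. Taking two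
  -- distinct names for `x` gives a contradiction.
  have key : ∀ x, EqE E x N := fun x => by
    have := hMN.abstr M x
    rwa [abstr_self hA,
      hN.abstr_eq_self fun P hP => h.abstr_eq_self hM (hΓ P hP) (hcon P hP)] at this
  exact h.not_eqE_names hM ((key _).trans (key _).symm)

/-! ### The cut-free system -/

/-- The messages that may occur in sequents. -/
def Msg.GroundNormal (R : Set (ETerm S ℕ × ETerm S ℕ)) (M : Msg S) : Prop :=
  M.Ground ∧ IsNormal R M

theorem Msg.GroundNormal.acEq {R : Set (ETerm S ℕ × ETerm S ℕ)} {M N : Msg S}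
    (hM : M.GroundNormal R) (h : ACEq M N) : N.GroundNormal R :=
  ⟨h.ground_iff.1 hM.1, h.isNormal hM.2⟩

/-- The binary constructors. -/
inductive IsBinary : (Msg S → Msg S → Msg S) → Prop
  | pair : IsBinary .pair
  | enc : IsBinary .enc
  | sign : IsBinary .sign
  | blind : IsBinary .blind

/-- `Decompose Γ o P Q`: a left rule applied to members of `Γ` adds `P` and `Q` to the context,
provided that the key in `o` can be derived. -/
inductive Decompose (Γ : Set (Msg S)) : Option (Msg S) → Msg S → Msg S → Prop
  | pair {M N : Msg S} (h : .pair M N ∈ Γ) : Decompose Γ none M N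
  | enc {M K : Msg S} (h : .enc M K ∈ Γ) : Decompose Γ (some K) M K
  | sign {M K L : Msg S} (h : .sign M K ∈ Γ) (h' : .pub L ∈ Γ) (hKL : ACEq K L) :
      Decompose Γ none M M
  | blind {M K : Msg S} (h : .blind M K ∈ Γ) : Decompose Γ (some K) M K
  | unblind {M R K : Msg S} (h : .sign (.blind M R) K ∈ Γ) : Decompose Γ (some R) (.sign M K) R

/-- Cut-free derivability. -/
inductive CutFree (E R : Set (ETerm S ℕ × ETerm S ℕ)) : Set (Msg S) → Msg S → Prop
  | id {Γ : Set (Msg S)} {M N : Msg S} (hΓ : ∀ P ∈ Γ, P.GroundNormal R) (hM : M.GroundNormal R)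
      (hN : Built Γ N) (h : EqE E M N) : CutFree E R Γ M
  | right {Γ : Set (Msg S)} {c : Msg S → Msg S → Msg S} {M K : Msg S} (hc : IsBinary c)
      (hcM : (c M K).GroundNormal R) (h : CutFree E R Γ M) (h' : CutFree E R Γ K) :
      CutFree E R Γ (c M K)
  | left {Γ : Set (Msg S)} {o : Option (Msg S)} {P Q T : Msg S} (hd : Decompose Γ o P Q)
      (ho : ∀ K ∈ o, CutFree E R Γ K) (h : CutFree E R (insert P (insert Q Γ)) T) :
      CutFree E R Γ T
  | acut {Γ : Set (Msg S)} {M A : Msg S} (hA : ∃ N ∈ insert M Γ, IsFactor A N)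
      (h : CutFree E R Γ A) (h' : CutFree E R (insert A Γ) M) : CutFree E R Γ M

variable {E R : Set (ETerm S ℕ × ETerm S ℕ)}

/-- The condition is imposed only at `id` and on the goals of right rules; elsewhere it is inherited
from a premise with the same goal and a larger context. -/
theorem CutFree.groundNormal {Γ : Set (Msg S)} {M : Msg S} (h : CutFree E R Γ M) :
    (∀ P ∈ Γ, P.GroundNormal R) ∧ M.GroundNormal R := by
  induction h with
  | id hΓ hM => exact ⟨hΓ, hM⟩
  | right _ hcM _ _ ih => exact ⟨ih.1, hcM⟩
  | left _ _ _ _ ih => exact ⟨fun P hP => ih.1 P (by simp [hP]), ih.2⟩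
  | acut _ _ _ _ ih => exact ⟨fun P hP => ih.1 P (by simp [hP]), ih.2⟩

theorem derivable_left {Γ : Set (Msg S)} {o : Option (Msg S)} {P Q T : Msg S}
    (hd : Decompose Γ o P Q) (hs : (⟨Γ, T⟩ : Sequent S).GroundNormal R)
    (ho : ∀ K ∈ o, Derivable E R {Rule.cut}ᶜ ⟨Γ, K⟩)
    (h : Derivable E R {Rule.cut}ᶜ ⟨insert P (insert Q Γ), T⟩) :
    Derivable E R {Rule.cut}ᶜ ⟨Γ, T⟩ := by
  cases hd with
  | pair hm => exact .infer (ρ := .pL) (by simp) (.pL T hm) hs (by simpa using h)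
  | enc hm =>
    exact .infer (ρ := .eL) (by simp) (.eL T hm) hs (by simpa using ⟨ho _ rfl, h⟩)
  | sign hm hm' hKL =>
    -- This rule adds one message, which `Decompose` lists twice; the double insertion collapses.
    exact .infer (ρ := .signL) (by simp) (.signL T hm hm' hKL) hs (by simpa using h)
  | blind hm =>
    exact .infer (ρ := .blindL1) (by simp) (.blindL1 T hm) hs (by simpa using ⟨ho _ rfl, h⟩)
  | unblind hm =>
    exact .infer (ρ := .blindL2) (by simp) (.blindL2 T hm) hs (by simpa using ⟨ho _ rfl, h⟩)

theorem CutFree.derivable {Γ : Set (Msg S)} {M : Msg S} (h : CutFree E R Γ M) :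
    Derivable E R {Rule.cut}ᶜ ⟨Γ, M⟩ := by
  have hs : (⟨Γ, M⟩ : Sequent S).GroundNormal R := h.groundNormal
  induction h with
  | id hΓ hM hN h =>
    obtain ⟨k, C, Ms, hMs, rfl⟩ := hN.exists_context
    exact .infer (ρ := .id) (by simp) (.id C Ms hMs h) hs (by simp)
  | right hc hcM h h' ih ih' =>
    have h₁ := ih h.groundNormal
    have h₂ := ih' h'.groundNormal
    cases hc with
    | pair => exact .infer (ρ := .pR) (by simp) (.pR _ _ _) hs (by simpa using ⟨h₁, h₂⟩)
    | enc => exact .infer (ρ := .eR) (by simp) (.eR _ _ _) hs (by simpa using ⟨h₁, h₂⟩)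
    | sign => exact .infer (ρ := .signR) (by simp) (.signR _ _ _) hs (by simpa using ⟨h₁, h₂⟩)
    | blind => exact .infer (ρ := .blindR) (by simp) (.blindR _ _ _) hs (by simpa using ⟨h₁, h₂⟩)
  | left hd ho h iho ih =>
    exact derivable_left hd hs (fun K hK => iho K hK (ho K hK).groundNormal) (ih h.groundNormal)
  | acut hA h h' ih ih' =>
    exact .infer (ρ := .acut) (by simp) (.acut hA) hs
      (by simpa using ⟨ih h.groundNormal, ih' h'.groundNormal⟩)

/-! ### Weakening and replacement modulo AC -/

/-- Every member of `Γ` is, up to AC, a member of `Δ`. -/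
def SubAC (Γ Δ : Set (Msg S)) : Prop :=
  ∀ P ∈ Γ, ∃ Q ∈ Δ, ACEq P Q

theorem SubAC.of_subset {Γ Δ : Set (Msg S)} (h : Γ ⊆ Δ) : SubAC Γ Δ :=
  fun P hP => ⟨P, h hP, .refl _⟩

theorem SubAC.insert {Γ Δ : Set (Msg S)} {P Q : Msg S} (h : SubAC Γ Δ) (hPQ : ACEq P Q) :
    SubAC (insert P Γ) (insert Q Δ) := by
  rintro M (rfl | hM)
  · exact ⟨Q, by simp, hPQ⟩
  · obtain ⟨N, hN, hMN⟩ := h M hM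
    exact ⟨N, by simp [hN], hMN⟩

theorem Decompose.acEq {Γ Δ : Set (Msg S)} (h : SubAC Γ Δ) {o : Option (Msg S)} {P Q : Msg S}
    (hd : Decompose Γ o P Q) : ∃ o' P' Q', Decompose Δ o' P' Q' ∧ ACEq P P' ∧ ACEq Q Q' ∧
      ∀ K' ∈ o', ∃ K ∈ o, ACEq K K' := by
  cases hd with
  | pair hm =>
    obtain ⟨_, hm', hac⟩ := h _ hm
    cases hac.sameHead with
    | pair h₁ h₂ => exact ⟨_, _, _, .pair hm', h₁, h₂, by simp⟩
  | enc hm =>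
    obtain ⟨_, hm', hac⟩ := h _ hm
    cases hac.sameHead with
    | enc h₁ h₂ => exact ⟨_, _, _, .enc hm', h₁, h₂, by simpa using h₂⟩
  | blind hm =>
    obtain ⟨_, hm', hac⟩ := h _ hm
    cases hac.sameHead with
    | blind h₁ h₂ => exact ⟨_, _, _, .blind hm', h₁, h₂, by simpa using h₂⟩
  | sign hm hp hKL =>
    obtain ⟨_, hm', hac⟩ := h _ hm
    obtain ⟨_, hp', hac'⟩ := h _ hp
    cases hac.sameHead with
    | sign h₁ h₂ =>
      cases hac'.sameHead with
      | pub h₃ => exact ⟨_, _, _, .sign hm' hp' ((h₂.symm.trans hKL).trans h₃), h₁, h₁, by simp⟩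
  | @unblind M R K hm =>
    obtain ⟨_, hm', hac⟩ := h _ hm
    cases hac.sameHead with
    | sign h₁ h₂ =>
      cases h₁.sameHead with
      | @blind _ M' _ R' h₃ h₄ =>
        refine ⟨_, _, _, .unblind hm', ?_, h₄, by simpa using h₄⟩
        exact (EqMod.map (fun X => .sign X K) (fun _ _ h => .of_step (.sign₁ K h)) h₃).trans
          (EqMod.map (fun X => .sign M' X) (fun _ _ h => .of_step (.sign₂ M' h)) h₂)

/-- Each rule is stable under AC: `id` because AC is part of the theory, right and left rules
because AC respects constructors, `acut` because it respects factors. Weakening is included. -/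
theorem CutFree.acEq {Γ Δ : Set (Msg S)} {M N : Msg S} (h : CutFree E R Γ M) (hs : SubAC Γ Δ)
    (hΔ : ∀ P ∈ Δ, P.GroundNormal R) (hMN : ACEq M N) : CutFree E R Δ N := by
  induction h generalizing Δ N with
  | id hΓ hM hN h =>
    obtain ⟨N', h₁, h₂⟩ := hN.bind (E := E) (Δ := Δ) fun P hP => by
      obtain ⟨Q, hQ, hPQ⟩ := hs P hP
      exact ⟨Q, hPQ.eqE, .mem hQ⟩
    exact .id hΔ (hM.acEq hMN) h₂ ((ACEq.eqE hMN.symm).trans (h.trans h₁))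
  | right hc hcM h h' ih ih' =>
    have hN := hcM.acEq hMN
    cases hc with
    | pair => cases hMN.sameHead with
      | pair h₁ h₂ => exact .right .pair hN (ih hs hΔ h₁) (ih' hs hΔ h₂)
    | enc => cases hMN.sameHead with
      | enc h₁ h₂ => exact .right .enc hN (ih hs hΔ h₁) (ih' hs hΔ h₂)
    | sign => cases hMN.sameHead with
      | sign h₁ h₂ => exact .right .sign hN (ih hs hΔ h₁) (ih' hs hΔ h₂)
    | blind => cases hMN.sameHead with
      | blind h₁ h₂ => exact .right .blind hN (ih hs hΔ h₁) (ih' hs hΔ h₂)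
  | left hd ho h iho ih =>
    obtain ⟨o', P', Q', hd', hP, hQ, ho'⟩ := hd.acEq hs
    have hgn := h.groundNormal.1
    refine .left hd' (fun K' hK' => ?_) (ih ((hs.insert hQ).insert hP) ?_ hMN)
    · obtain ⟨K, hK, hKK'⟩ := ho' K' hK'
      exact iho K hK hs hΔ hKK'
    · rintro X (rfl | rfl | hX)
      · exact (hgn _ (by simp)).acEq hP
      · exact (hgn _ (by simp)).acEq hQ
      · exact hΔ X hX
  | @acut Γ M A hA h h' ih ih' =>
    obtain ⟨X, hX, hAX⟩ := hA
    obtain ⟨Y, hY, hXY⟩ := hs.insert hMN X hX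
    obtain ⟨A', hAA', hA'Y⟩ := hXY.factorAC_iff.1 ⟨A, .refl _, hAX⟩
    refine .acut ⟨Y, hY, hA'Y⟩ (ih hs hΔ hAA') (ih' (hs.insert hAA') ?_ hMN)
    rintro Z (rfl | hZ)
    · exact h.groundNormal.2.acEq hAA'
    · exact hΔ Z hZ

theorem CutFree.weaken {Γ Δ : Set (Msg S)} {M : Msg S} (h : CutFree E R Γ M) (hs : Γ ⊆ Δ)
    (hΔ : ∀ P ∈ Δ, P.GroundNormal R) : CutFree E R Δ M :=
  h.acEq (.of_subset hs) hΔ (.refl _)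

/-- A context from which something is derivable is nonempty, or there is a closed term. -/
theorem CutFree.exists_built {Γ : Set (Msg S)} {M : Msg S} (h : CutFree E R Γ M) :
    ∃ N, Built Γ N := by
  induction h with
  | id _ _ hN _ => exact ⟨_, hN⟩
  | right _ _ _ _ ih => exact ih
  | left hd => cases hd <;> exact ⟨_, .mem (by assumption)⟩
  | acut _ _ _ ih => exact ih

/-! ### Admissibility of cut -/

/-- Cut on `M` is admissible in the cut-free system. -/
def CutOn (E R : Set (ETerm S ℕ × ETerm S ℕ)) (M : Msg S) : Prop :=
  ∀ Γ T, CutFree E R Γ M → CutFree E R (insert M Γ) T → CutFree E R Γ T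

/-- A cut on an alien that occurs in the sequent, up to AC, is an analytic cut or a
weakening. -/
theorem CutFree.cut_alienIn {Γ : Set (Msg S)} {M T : Msg S} (hM : CutFree E R Γ M)
    (hT : CutFree E R (insert M Γ) T) (h : ∃ P ∈ insert T Γ, AlienIn M P) : CutFree E R Γ T := by
  have hΓ := hM.groundNormal.1
  obtain ⟨P, hP, ⟨-, hac⟩ | ⟨M', hac, hf⟩⟩ := h
  · rcases hP with rfl | hP
    -- `M` is the goal up to AC, so the left premise suffices; in the next case `M` is already a
    -- hypothesis up to AC.
    · exact hM.acEq (.of_subset subset_rfl) hΓ hac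
    · refine hT.acEq ?_ hΓ (.refl _)
      rintro X (rfl | hX)
      · exact ⟨P, hP, hac⟩
      · exact ⟨X, hX, .refl _⟩
  · refine .acut ⟨P, hP, hf⟩ (hM.acEq (.of_subset subset_rfl) hΓ hac)
      (hT.acEq (SubAC.insert (.of_subset subset_rfl) hac) ?_ (.refl _))
    rintro X (rfl | hX)
    · exact hM.groundNormal.2.acEq hac
    · exact hΓ X hX

/-- A cut on a factor of the sequent or of a message below which cuts are admissible. -/
theorem CutFree.cut_factor {Γ : Set (Msg S)} {M A T : Msg S}
    (hcut : ∀ A : Msg S, A.size < M.size → CutOn E R A)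
    (hA : IsFactor A M ∨ ∃ N ∈ insert T Γ, IsFactor A N)
    (h : CutFree E R Γ A) (h' : CutFree E R (insert A Γ) T) : CutFree E R Γ T := by
  rcases hA with hA | hA
  · exact hcut A hA.size_lt Γ T h h'
  · exact .acut hA h h'

/-- Permutation of a cut upwards in the right premise, where `L Γ` is what is known about the
derivation of the cut message from `Γ`. -/
theorem CutFree.cut_right {M : Msg S} (hcut : ∀ A : Msg S, A.size < M.size → CutOn E R A)
    (L : Set (Msg S) → Prop)
    (hL : ∀ Γ Δ, Γ ⊆ Δ → (∀ P ∈ Δ, P.GroundNormal R) → L Γ → L Δ)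
    (hid : ∀ Γ T N, L Γ → (∀ P ∈ Γ, P.GroundNormal R) → T.GroundNormal R →
      Built (insert M Γ) N → EqE E T N → CutFree E R Γ T)
    (hdec : ∀ Γ o P Q, L Γ → Decompose (insert M Γ) o P Q → (∀ K ∈ o, CutFree E R Γ K) →
      (∀ X ∈ insert P (insert Q Γ), X.GroundNormal R) →
      Decompose Γ o P Q ∨ ∀ T, CutFree E R (insert P (insert Q Γ)) T → CutFree E R Γ T)
    {Γ : Set (Msg S)} {T : Msg S} (h : CutFree E R (insert M Γ) T) (hΓ : L Γ) :
    CutFree E R Γ T := by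
  generalize hΔ : insert M Γ = Δ at h
  induction h generalizing Γ with
  | id hgn hT hN h =>
    subst hΔ
    exact hid _ _ _ hΓ (fun P hP => hgn P (by simp [hP])) hT hN h
  | right hc hcM _ _ ih ih' => exact .right hc hcM (ih hΓ hΔ) (ih' hΓ hΔ)
  | @left _ o P Q T hd ho h iho ih =>
    subst hΔ
    have hgn : ∀ X ∈ insert P (insert Q Γ), X.GroundNormal R := fun X hX =>
      h.groundNormal.1 X (by
        rcases hX with hX | hX | hX <;> simp [hX])
    have ho' : ∀ K ∈ o, CutFree E R Γ K := fun K hK => iho K hK hΓ rfl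
    have h' : CutFree E R (insert P (insert Q Γ)) T :=
      ih (hL _ _ (fun X hX => by simp [hX]) hgn hΓ)
        (by rw [Set.insert_comm M P, Set.insert_comm M Q])
    rcases hdec Γ o P Q hΓ hd ho' hgn with hd' | hT
    · exact .left hd' ho' h'
    · exact hT T h'
  | @acut _ T A hA h h' ih ih' =>
    subst hΔ
    have h₁ := ih hΓ rfl
    have h₂ : CutFree E R (insert A Γ) T := by
      refine ih' (hL _ _ (fun X hX => by simp [hX]) ?_ hΓ) (Set.insert_comm _ _ _)
      intro X hX
      exact h'.groundNormal.1 X (by rcases hX with hX | hX <;> simp [hX])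
    refine cut_factor hcut ?_ h₁ h₂
    obtain ⟨N, rfl | rfl | hN, hA⟩ := hA
    · exact .inr ⟨N, by simp, hA⟩
    -- A factor of `M` need not be one of the conclusion, but it is smaller than `M`, so an ordinary
    -- cut is available.
    · exact .inl hA
    · exact .inr ⟨N, by simp [hN], hA⟩

/-- The messages on which left rules act are all headed by constructors. -/
theorem Decompose.of_insert {Γ : Set (Msg S)} {M : Msg S} (hM : ¬ M.Alien)
    {o : Option (Msg S)} {P Q : Msg S} (h : Decompose (insert M Γ) o P Q) :
    Decompose Γ o P Q := by
  have key : ∀ X : Msg S, X.Alien → X ∈ insert M Γ → X ∈ Γ := by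
    rintro X hX (rfl | h)
    · exact (hM hX).elim
    · exact h
  cases h with
  | pair h => exact .pair (key _ trivial h)
  | enc h => exact .enc (key _ trivial h)
  | sign h h' hKL => exact .sign (key _ trivial h) (key _ trivial h') hKL
  | blind h => exact .blind (key _ trivial h)
  | unblind h => exact .unblind (key _ trivial h)

theorem IsBinary.alien {c : Msg S → Msg S → Msg S} (hc : IsBinary c) (M K : Msg S) :
    (c M K).Alien := by
  cases hc <;> trivial

/-- A cut between a right rule and an instance of the identity rule. -/
theorem CutFree.cut_right_id (hconv : ACConvergent E R) {Γ : Set (Msg S)} {M T N : Msg S}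
    (hM : CutFree E R Γ M) (hA : M.Alien) (hT : T.GroundNormal R) (hN : Built (insert M Γ) N)
    (hTN : EqE E T N) : CutFree E R Γ T := by
  obtain ⟨hΓ, hMgn⟩ := hM.groundNormal
  by_cases hocc : ∃ P ∈ insert T Γ, AlienIn M P
  · refine hM.cut_alienIn (.id ?_ hT hN hTN) hocc
    rintro X (rfl | hX)
    · exact hMgn
    · exact hΓ X hX
  · push Not at hocc
    -- Any `x` built from the context will do: after abstraction, `T` is unchanged and equals a
    -- message built from `Γ` alone.
    obtain ⟨x, hx⟩ := hM.exists_built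
    have h := hTN.abstr M x
    rw [hconv.abstr_eq_self hMgn.2 hT.2 (hocc T (by simp))] at h
    refine .id hΓ hT (hN.abstr ?_) h
    rintro P (rfl | hP)
    · rwa [abstr_self hA]
    · rw [hconv.abstr_eq_self hMgn.2 (hΓ P hP).2 (hocc P (by simp [hP]))]
      exact .mem hP

/-- A cut between a right rule and a left rule, when the cut message is principal. -/
theorem CutFree.cut_principal {Γ : Set (Msg S)} {c : Msg S → Msg S → Msg S} {M K : Msg S}
    (hc : IsBinary c) (hcut : ∀ A : Msg S, A.size < (c M K).size → CutOn E R A)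
    (hM : CutFree E R Γ M) (hK : CutFree E R Γ K)
    {o : Option (Msg S)} {P Q : Msg S} (hd : Decompose (insert (c M K) Γ) o P Q)
    (ho : ∀ K ∈ o, CutFree E R Γ K) (hgn : ∀ X ∈ insert P (insert Q Γ), X.GroundNormal R) :
    Decompose Γ o P Q ∨ ∀ T, CutFree E R (insert P (insert Q Γ)) T → CutFree E R Γ T := by
  -- Two successive cuts on smaller messages remove what the left rule added.
  have key : ∀ P Q : Msg S, P.size < (c M K).size → Q.size < (c M K).size →
      (∀ X ∈ insert P (insert Q Γ), X.GroundNormal R) →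
      CutFree E R Γ P → CutFree E R Γ Q → ∀ T, CutFree E R (insert P (insert Q Γ)) T →
      CutFree E R Γ T := by
    intro P Q hsP hsQ hgn hP hQ T hT
    refine hcut Q hsQ Γ T hQ (hcut P hsP _ T (hP.weaken (by simp) ?_) hT)
    exact fun X hX => hgn X (by simp only [Set.mem_insert_iff] at hX ⊢; tauto)
  cases hd with
  | pair h =>
    rcases h with h | h
    · cases hc <;> cases h
      exact .inr (key _ _ (by simp only [Msg.size]; omega) (by simp only [Msg.size]; omega)
        hgn hM hK)
    · exact .inl (.pair h)
  | enc h =>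
    rcases h with h | h
    · cases hc <;> cases h
      exact .inr (key _ _ (by simp only [Msg.size]; omega) (by simp only [Msg.size]; omega)
        hgn hM hK)
    · exact .inl (.enc h)
  | blind h =>
    rcases h with h | h
    · cases hc <;> cases h
      exact .inr (key _ _ (by simp only [Msg.size]; omega) (by simp only [Msg.size]; omega)
        hgn hM hK)
    · exact .inl (.blind h)
  | sign h h' hKL =>
    -- The cut message is a binary constructor, hence is not the `pub` hypothesis.
    replace h' : _ ∈ Γ := h'.resolve_left (by cases hc <;> simp)
    rcases h with h | h
    · cases hc <;> cases h
      exact .inr (key _ _ (by simp only [Msg.size]; omega) (by simp only [Msg.size]; omega)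
        hgn hM hM)
    · exact .inl (.sign h h' hKL)
  | @unblind N _ K' h =>
    rcases h with h | h
    · obtain ⟨rfl, rfl, rfl⟩ : c = .sign ∧ M = .blind N Q ∧ K = K' := by
        cases hc <;> cases h
        exact ⟨rfl, rfl, rfl⟩
      have hQ := ho _ rfl
      have hΓ := hQ.groundNormal.1
      have hNgn : N.GroundNormal R := by
        have := hgn (.sign N K) (by simp)
        exact ⟨this.1.1, (ImmSubterm.sign₁ N K).isNormal this.2⟩
      have hgn' : ∀ X ∈ insert (.blind N Q) Γ, X.GroundNormal R := by
        rintro X (rfl | hX)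
        · exact hM.groundNormal.2
        · exact hΓ X hX
      -- The right rule supplies `blind N Q`, not `N`. Unblinding it with the derivable key `Q`, by
      -- a cut on this smaller message, yields `N`; signing `N` again gives the smaller message to
      -- cut on.
      have hN : CutFree E R Γ N := by
        refine hcut (.blind N Q) (by simp only [Msg.size]; omega) Γ N hM ?_
        refine .left (.blind (Set.mem_insert _ _)) (o := some Q) ?_
          (.id ?_ hNgn (.mem (Set.mem_insert _ _)) (.refl _))
        · rintro _ ⟨⟩
          exact hQ.weaken (by simp) hgn'
        · rintro X (rfl | rfl | hX)
          · exact hNgn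
          · exact hQ.groundNormal.2
          · exact hgn' X hX
      exact .inr (key _ _ (by simp only [Msg.size]; omega) (by simp only [Msg.size]; omega)
        hgn (.right .sign (hgn _ (by simp)) hN hK) hQ)
    · exact .inl (.unblind h)

/-- Induction on the left premise: left rules and `acut` permute below the cut, while `id` on a
non-alien and right rules pass to `CutFree.cut_right`. There the left premise is recorded by a
property that survives enlarging the context. -/
theorem cutOn_of_forall_size_lt (hconv : ACConvergent E R) {M : Msg S}
    (hcut : ∀ A : Msg S, A.size < M.size → CutOn E R A) : CutOn E R M := by
  intro Γ T hM hT
  induction hM generalizing T with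
  | @id Γ M N hΓ hM hN h =>
    by_cases hA : M.Alien
    · obtain ⟨P, hP, hMP⟩ :=
        hconv.exists_alienIn_of_built (fun P hP => (hΓ P hP).2) hM.2 hA h hN
      exact CutFree.cut_alienIn (.id hΓ hM hN h) hT ⟨P, by simp [hP], hMP⟩
    · refine CutFree.cut_right hcut (fun Γ => ∃ N, EqE E M N ∧ Built Γ N) ?_ ?_ ?_ hT ⟨N, h, hN⟩
      · rintro Γ Δ hs - ⟨N, h, hN⟩
        obtain ⟨N', h₁, h₂⟩ := hN.bind (E := E) (Δ := Δ)
          fun P hP => ⟨P, .refl _, .mem (hs hP)⟩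
        exact ⟨N', h.trans h₁, h₂⟩
      · rintro Γ T N' ⟨N, h, hN⟩ hΓ hT hN' hTN'
        obtain ⟨N₁, h₁, h₂⟩ := hN'.bind (E := E) (Δ := Γ) (by
          rintro P (rfl | hP)
          · exact ⟨N, h, hN⟩
          · exact ⟨P, .refl _, .mem hP⟩)
        exact .id hΓ hT h₂ (hTN'.trans h₁)
      · exact fun Γ o P Q _ hd _ _ => .inl (hd.of_insert hA)
  | @right Γ c M K hc hcM hM hK =>
    refine CutFree.cut_right hcut (fun Γ => CutFree E R Γ M ∧ CutFree E R Γ K) ?_ ?_ ?_ hT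
      ⟨hM, hK⟩
    · exact fun Γ Δ hs hΔ h => ⟨h.1.weaken hs hΔ, h.2.weaken hs hΔ⟩
    · exact fun Γ T N hL hΓ hT hN hTN =>
        CutFree.cut_right_id hconv (.right hc hcM hL.1 hL.2) (hc.alien M K) hT hN hTN
    · exact fun Γ o P Q hL hd ho hgn => CutFree.cut_principal hc hcut hL.1 hL.2 hd ho hgn
  | @left Γ o P Q M hd ho h _ ih =>
    refine .left hd ho (ih hcut T (hT.weaken (Set.insert_subset_insert ?_) ?_))
    · exact fun X hX => by simp [hX]
    · rintro X (rfl | hX)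
      · exact h.groundNormal.2
      · exact h.groundNormal.1 X hX
  | @acut Γ M A hA h h' _ ih' =>
    refine CutFree.cut_factor hcut ?_ h
      (ih' hcut T (hT.weaken (Set.insert_subset_insert fun X hX => by simp [hX]) ?_))
    · obtain ⟨N, rfl | hN, hA⟩ := hA
      · exact .inl hA
      · exact .inr ⟨N, by simp [hN], hA⟩
    · rintro X (rfl | hX)
      · exact h'.groundNormal.2
      · exact h'.groundNormal.1 X hX

theorem cutOn (hconv : ACConvergent E R) (M : Msg S) : CutOn E R M := by
  induction hn : M.size using Nat.strong_induction_on generalizing M with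
  | _ n ih =>
    subst hn
    exact cutOn_of_forall_size_lt hconv fun A hA => ih A.size hA A rfl

theorem Derivable.cutFree (hconv : ACConvergent E R) {s : Sequent S}
    (h : Derivable E R Set.univ s) : CutFree E R s.ctx s.goal := by
  induction h with
  | infer _ hinst hc _ ih =>
    cases hinst with
    | id C Ms hΓ hM => exact .id hc.1 hc.2 (C.built_fill hΓ) hM
    | cut Γ M T => exact cutOn hconv M Γ T (ih ⟨Γ, M⟩ (by simp)) (ih ⟨insert M Γ, T⟩ (by simp))
    | pL T h => exact .left (.pair h) (by simp) (ih _ (List.mem_singleton_self _))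
    | eL T h =>
      simp only [List.mem_cons, List.not_mem_nil, or_false, forall_eq_or_imp, forall_eq] at ih
      exact .left (.enc h) (by simpa using ih.1) ih.2
    | signL T h h' hKL =>
      have := ih _ (List.mem_singleton_self _)
      exact .left (.sign h h' hKL) (by simp) (by simpa using this)
    | blindL1 T h =>
      simp only [List.mem_cons, List.not_mem_nil, or_false, forall_eq_or_imp, forall_eq] at ih
      exact .left (.blind h) (by simpa using ih.1) ih.2
    | blindL2 T h =>
      simp only [List.mem_cons, List.not_mem_nil, or_false, forall_eq_or_imp, forall_eq] at ih
      exact .left (.unblind h) (by simpa using ih.1) ih.2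
    | acut h =>
      simp only [List.mem_cons, List.not_mem_nil, or_false, forall_eq_or_imp, forall_eq] at ih
      exact .acut h ih.1 ih.2
    | pR Γ M N =>
      exact .right .pair hc.2 (ih ⟨Γ, M⟩ (by simp)) (ih ⟨Γ, N⟩ (by simp))
    | eR Γ M N =>
      exact .right .enc hc.2 (ih ⟨Γ, M⟩ (by simp)) (ih ⟨Γ, N⟩ (by simp))
    | signR Γ M N =>
      exact .right .sign hc.2 (ih ⟨Γ, M⟩ (by simp)) (ih ⟨Γ, N⟩ (by simp))
    | blindR Γ M N =>
      exact .right .blind hc.2 (ih ⟨Γ, M⟩ (by simp)) (ih ⟨Γ, N⟩ (by simp))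

end Intruder

theorem mainTheorem2 (S : Intruder.Signature)
    (E R : Set (Intruder.ETerm S ℕ × Intruder.ETerm S ℕ))
    (h : Intruder.ACConvergent E R) :
    Intruder.Admissible E R Intruder.Rule.cut :=
  fun _ hs => (hs.cutFree h).derivable
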